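/- Work on $\mathbb C^3\otimes\mathbb C^3$ with the Hilbert–Schmidt inner product $\langle A,B\rangle=\operatorname{Tr}A^\dagger B$ and norm $\|A\|=\sqrt{\langle A,A\rangle}$. Let $S$ be the set of separable states (convex combinations of products $A\otimes B$ of density matrices); a state is entangled if it is not in $S$, and its HS measure is $D(\rho)=\min_{\sigma\in S}\|\sigma-\rho\|$. An entanglement witness for a state $\rho$ is a Hermitian operator $A$ with $\langle\rho,A\rangle<0$ and $\langle\sigma,A\rangle\ge 0$ for all $\sigma\in S$. For $n,m\in\mathbb Z/3$ let $U_{nm}=\sum_{k=0}^{2}e^{2\pi i kn/3}\,|k\rangle\langle (k+m)\bmod 3|$ be the Weyl operators, let $|\phi_+\rangle=\frac1{\sqrt3}\sum_j|j\rangle\otimes|j\rangle$, let $P_{nk}=(U_{nk}\otimes\mathbb 1)|\phi_+\rangle\langle\phi_+|(U_{nk}^\dagger\otimes\mathbb 1)$ be the Bell projectors, and put $$U=\sum_{(l,m)\ne(0,0)}U_{lm}\otimes U_{-l\,m},\qquad U_1=\sum_{l\in\mathbb Z/3,\ m\neq 0}U_{lm}\otimes U_{-l\,m},\qquad U_2=U_{10}\otimes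 U_{-1\,0}+U_{20}\otimes U_{-2\,0}.$$ For $\alpha,\beta\in\mathbb R$ let $$\rho_{\alpha,\beta}=\frac{1-\alpha-\beta}{9}\,\mathbb 1+\alpha P_{00}+\frac{\beta}{2}(P_{10}+P_{20}).$$ Let Region I be the set of $(\alpha,\beta)$ with $\alpha\le\frac72\beta+1$, $\alpha\le-\beta+1$, $\alpha>\frac{\beta}{8}+\frac14$, and Region II the set of $(\alpha,\beta)$ with $\alpha<\frac54\beta-\frac12$, $\alpha\ge\frac18\beta-\frac18$, $\alpha\le-\beta+1$. For $\tilde\rho\ne\rho$ put $$\tilde C(\tilde\rho,\rho)=\frac{\tilde\rho-\rho-\langle\tilde\rho,\tilde\rho-\rho\rangle\mathbb 1}{\|\tilde\rho-\rho\|}.$$ Then for all real $\alpha,\beta$ one has $\rho_{\alpha,\beta}=\frac19\left(\mathbb 1+(\alpha-\frac\beta2)U_1+(\alpha+\beta)U_2\right)$, and $\rho_{\alpha,\beta}$ is an entangled state if and only if $(\alpha,\beta)$ lies in Region I or in Region II. Moreover: (I) If $(\alpha,\beta)$ is in Region I, then the unique nearest separable state to $\rho_{\alpha,\beta}$ is $$\tilde\rho_\beta=\rho_{\frac14+\frac18\beta,\,\beta}=\frac19\left(\mathbb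 1+\left(\tfrac14-\tfrac38\beta\right)U_1+\left(\tfrac14+\tfrac98\beta\right)U_2\right),$$ the HS measure is $$D(\rho_{\alpha,\beta})=\|\tilde\rho_\beta-\rho_{\alpha,\beta}\|=\frac{2\sqrt2}{3}\left(\alpha-\frac14-\frac18\beta\right),$$ and $\tilde C(\tilde\rho_\beta,\rho_{\alpha,\beta})=\frac1{6\sqrt2}(2\,\mathbb 1-U)$ is an entanglement witness for $\rho_{\alpha,\beta}$, with $\langle\rho_{\alpha,\beta},\tilde C\rangle=-D(\rho_{\alpha,\beta})$. (II) If $(\alpha,\beta)$ is in Region II, then the unique nearest separable state to $\rho_{\alpha,\beta}$ is $\tilde\rho_{\alpha,\beta}=\rho_{\tilde\alpha,\tilde\beta}$ with $\tilde\alpha=\frac1{24}(-2+20\alpha+5\beta)$ and $\tilde\beta=\frac16(2+4\alpha+\beta)$, the HS measure is $$D(\rho_{\alpha,\beta})=\|\tilde\rho_{\alpha,\beta}-\rho_{\alpha,\beta}\|=\frac{1}{6\sqrt2}\left(-4\alpha-2+5\beta\right),$$ and $\tilde C(\tilde\rho_{\alpha,\beta},\rho_{\alpha,\beta})=\frac1{6\sqrt2}(2\,\mathbb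 1+U_1-U_2)$ is an entanglement witness for $\rho_{\alpha,\beta}$, with $\langle\rho_{\alpha,\beta},\tilde C\rangle=-D(\rho_{\alpha,\beta})$. -/

import Mathlib

open scoped Matrix Kronecker ComplexOrder

namespace TwoQudit

noncomputable section

/-- Operators on `ℂ^d ⊗ ℂ^d`, written in the product basis `|i⟩ ⊗ |j⟩`. -/
abbrev Op (d : ℕ) := Matrix (Fin d × Fin d) (Fin d × Fin d) ℂ

/-- A density matrix: positive semidefinite (in particular Hermitian) of trace one. -/
def IsDensity {ι : Type*} [Fintype ι] (ρ : Matrix ι ι ℂ) : Prop :=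
  ρ.PosSemidef ∧ ρ.trace = 1

/-- The set `S` of separable states: convex combinations of products of density matrices. -/
def separableStates (d : ℕ) : Set (Op d) :=
  convexHull ℝ {σ | ∃ A B : Matrix (Fin d) (Fin d) ℂ,
    IsDensity A ∧ IsDensity B ∧ σ = A ⊗ₖ B}

/-- An entangled state: a density matrix that is not separable. -/
def IsEntangled {d : ℕ} (ρ : Op d) : Prop :=
  IsDensity ρ ∧ ρ ∉ separableStates d

/-- The Hilbert–Schmidt inner product `⟨A, B⟩ = Tr (A† B)`. -/
def hsInner {d : ℕ} (A B : Op d) : ℂ := (Aᴴ * B).trace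

/-- The Hilbert–Schmidt norm `‖A‖ = √⟨A, A⟩`. -/
def hsNorm {d : ℕ} (A : Op d) : ℝ := √(hsInner A A).re

/-- The Hilbert–Schmidt measure: the distance to the set of separable states. -/
def hsMeasure {d : ℕ} (ρ : Op d) : ℝ :=
  sInf ((fun σ : Op d => hsNorm (σ - ρ)) '' separableStates d)

/-- `ρ₀` is the nearest separable state to `ρ`: it is separable, and every other separable state
is strictly farther away from `ρ`. -/
def IsNearestSeparable {d : ℕ} (ρ ρ₀ : Op d) : Prop :=
  ρ₀ ∈ separableStates d ∧
    ∀ σ ∈ separableStates d, σ ≠ ρ₀ → hsNorm (ρ₀ - ρ) < hsNorm (σ - ρ)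

/-- `A` is an entanglement witness that detects `ρ`.  (For Hermitian `A` and states `σ` the
numbers `⟨σ, A⟩` are real.) -/
def IsWitness {d : ℕ} (A ρ : Op d) : Prop :=
  A.IsHermitian ∧ (hsInner ρ A).re < 0 ∧ ∀ σ ∈ separableStates d, 0 ≤ (hsInner σ A).re

/-- The operator `(ρ₀ - ρ - ⟨ρ₀, ρ₀ - ρ⟩ 𝟙) / ‖ρ₀ - ρ‖`. -/
def witnessOp {d : ℕ} (ρ₀ ρ : Op d) : Op d :=
  ((hsNorm (ρ₀ - ρ) : ℂ))⁻¹ • (ρ₀ - ρ - hsInner ρ₀ (ρ₀ - ρ) • (1 : Op d))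

/-- The Weyl operator `U_{nm} = ∑ₖ e^{2πi kn/d} |k⟩⟨(k+m) mod d|`; the indices are residues
modulo `d`, and `+`, `-` on `Fin d` are taken modulo `d`. -/
def weyl {d : ℕ} (n m : Fin d) : Matrix (Fin d) (Fin d) ℂ :=
  Matrix.of fun k l =>
    if l = k + m then Complex.exp (2 * Real.pi * Complex.I / d * (k.val * n.val)) else 0

/-- The maximally entangled vector `|φ₊⟩ = d^{-1/2} ∑ⱼ |j⟩ ⊗ |j⟩`. -/
def phiPlus (d : ℕ) : Fin d × Fin d → ℂ :=
  fun p => if p.1 = p.2 then ((√(d : ℝ) : ℝ) : ℂ)⁻¹ else 0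

/-- The Bell projector `P_{nk} = (U_{nk} ⊗ 𝟙) |φ₊⟩⟨φ₊| (U_{nk}† ⊗ 𝟙)`. -/
def bell {d : ℕ} (n k : Fin d) : Op d :=
  (weyl n k ⊗ₖ (1 : Matrix (Fin d) (Fin d) ℂ)) *
    Matrix.vecMulVec (phiPlus d) (star (phiPlus d)) *
    ((weyl n k)ᴴ ⊗ₖ (1 : Matrix (Fin d) (Fin d) ℂ))

/-- `U_{lm} ⊗ U_{-l m}`. -/
def weylPair (l m : Fin 3) : Op 3 := weyl l m ⊗ₖ weyl (-l) m

/-- `U = ∑_{(l,m) ≠ (0,0)} U_{lm} ⊗ U_{-l m}`. -/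
def opU : Op 3 :=
  ∑ p ∈ (Finset.univ : Finset (Fin 3 × Fin 3)).erase (0, 0), weylPair p.1 p.2

/-- The part `U₁` of `U`: the terms with `m ≠ 0`. -/
def opU₁ : Op 3 :=
  weylPair 0 1 + weylPair 0 2 + weylPair 1 1 + weylPair 1 2 + weylPair 2 1 + weylPair 2 2

/-- The part `U₂` of `U`: the terms with `m = 0`. -/
def opU₂ : Op 3 := weylPair 1 0 + weylPair 2 0

/-- The two-parameter two-qutrit operators
`ρ_{α,β} = (1-α-β)/9 𝟙 + α P₀₀ + (β/2) (P₁₀ + P₂₀)`. -/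
def rho (α β : ℝ) : Op 3 :=
  ((1 - α - β) / 9) • (1 : Op 3) + α • bell 0 0 + (β / 2) • (bell 1 0 + bell 2 0)

/-- The operators `(1/9) (𝟙 + a U₁ + b U₂)`. -/
def bloch (a b : ℝ) : Op 3 :=
  (1 / 9 : ℝ) • ((1 : Op 3) + a • opU₁ + b • opU₂)

/-- Region I of the parameter plane. -/
def RegionI (α β : ℝ) : Prop :=
  α ≤ 7 / 2 * β + 1 ∧ α ≤ -β + 1 ∧ β / 8 + 1 / 4 < α

/-- Region II of the parameter plane. -/
def RegionII (α β : ℝ) : Prop :=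
  α < 5 / 4 * β - 1 / 2 ∧ 1 / 8 * β - 1 / 8 ≤ α ∧ α ≤ -β + 1

end

end TwoQudit

/-!
If a hyperplane orthogonal to `ρ₀ - ρ` supports the convex set of separable states at `ρ₀`, then
`ρ₀` is the nearest separable state to `ρ`, and the equation of the hyperplane is the witness. All
operators of the theorem have the form `x 𝟙 + y D + z J`, where `D` is the projector onto the span
of the `|j⟩ ⊗ |j⟩` and `J = ∑ |i i⟩⟨j j|`.

For `|s| ≤ 1` the operator `𝟙 - (1 + s) D + s J` is nonnegative on products `A ⊗ B`, because
`2 |Re (A i j * B i j)| ≤ A i i * B j j + A j j * B i i` if `A` and `B` are positive semidefinite;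
hence a separable `x 𝟙 + y D + z J` has `|z| ≤ x`. Conversely, averaging product states over the
unitaries `Θ ⊗ Θ†` with `Θ` diagonal produces enough separable operators of this form to make every
density matrix with `|z| ≤ x` separable. The two facets `z = x` and `z = -x` carry the nearest
separable states of Region I (`s = -1`) and of Region II (`s = 1`).
-/

namespace TwoQudit

section HilbertSchmidt

variable {d : ℕ}

theorem hsInner_add_left (A B C : Op d) : hsInner (A + B) C = hsInner A C + hsInner B C := by
  simp [hsInner, Matrix.add_mul]

theorem hsInner_sub_left (A B C : Op d) : hsInner (A - B) C = hsInner A C - hsInner B C := by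
  simp [hsInner, Matrix.sub_mul]

theorem hsInner_smul_left (r : ℝ) (A B : Op d) : hsInner (r • A) B = r * hsInner A B := by
  simp [hsInner]

theorem hsInner_add_right (A B C : Op d) : hsInner A (B + C) = hsInner A B + hsInner A C := by
  simp [hsInner, Matrix.mul_add]

theorem hsInner_smul_right (r : ℝ) (A B : Op d) : hsInner A (r • B) = r * hsInner A B := by
  simp [hsInner]

theorem hsInner_one_right (A : Op d) : hsInner A 1 = star A.trace := by
  simp [hsInner, Matrix.trace_conjTranspose]

theorem star_hsInner (A B : Op d) : star (hsInner A B) = hsInner B A := by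
  simp [hsInner, ← Matrix.trace_conjTranspose]

theorem hsInner_self_nonneg (A : Op d) : 0 ≤ hsInner A A :=
  (Matrix.posSemidef_conjTranspose_mul_self A).trace_nonneg

theorem hsInner_self_eq_zero {A : Op d} : hsInner A A = 0 ↔ A = 0 :=
  Matrix.trace_conjTranspose_mul_self_eq_zero_iff

theorem hsInner_self (A : Op d) : hsInner A A = ((hsNorm A ^ 2 : ℝ) : ℂ) := by
  have hA := Complex.le_def.1 (hsInner_self_nonneg A)
  rw [hsNorm, Real.sq_sqrt hA.1]
  exact Complex.ext rfl hA.2.symm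

theorem hsNorm_pos {A : Op d} (hA : A ≠ 0) : 0 < hsNorm A := by
  refine (Real.sqrt_nonneg _).lt_of_ne' fun h => hA (hsInner_self_eq_zero.1 ?_)
  rw [hsInner_self, hsNorm, h]
  simp

theorem hsNorm_smul {t : ℝ} (ht : 0 ≤ t) (A : Op d) : hsNorm (t • A) = t * hsNorm A := by
  rw [hsNorm, hsInner_smul_left, hsInner_smul_right, Complex.re_ofReal_mul, Complex.re_ofReal_mul,
    ← mul_assoc, Real.sqrt_mul (mul_self_nonneg t), Real.sqrt_mul_self ht, hsNorm]

theorem hsNorm_add_sq (A B : Op d) :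
    hsNorm (A + B) ^ 2 = hsNorm A ^ 2 + 2 * (hsInner A B).re + hsNorm B ^ 2 := by
  have hsymm : (hsInner B A).re = (hsInner A B).re := by
    rw [← star_hsInner A B, Complex.star_def, Complex.conj_re]
  have hsq (C : Op d) : hsNorm C ^ 2 = (hsInner C C).re := by
    rw [hsInner_self, Complex.ofReal_re]
  simp only [hsq, hsInner_add_left, hsInner_add_right, Complex.add_re, hsymm]
  ring

end HilbertSchmidt

section SeparableStates

variable {d : ℕ}

theorem convex_separableStates : Convex ℝ (separableStates d) :=
  convex_convexHull ℝ _

theorem trace_of_mem_separableStates {σ : Op d} (hσ : σ ∈ separableStates d) : σ.trace = 1 := by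
  refine convexHull_min (t := {σ : Op d | σ.trace = 1}) ?_ ?_ hσ
  · rintro _ ⟨A, B, hA, hB, rfl⟩
    simp [Matrix.trace_kronecker, hA.2, hB.2]
  · exact convex_hyperplane (Matrix.traceLinearMap _ ℝ ℂ).isLinear _

theorem hsInner_smul_one_add_of_mem_separableStates (c : ℝ) {σ V : Op d}
    (hσ : σ ∈ separableStates d) : hsInner σ (c • (1 : Op d) + V) = c + hsInner σ V := by
  rw [hsInner_add_right, hsInner_smul_right, hsInner_one_right, trace_of_mem_separableStates hσ,
    star_one, mul_one]

theorem re_hsInner_nonneg_of_mem_separableStates {W : Op d}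
    (hW : ∀ A B : Matrix (Fin d) (Fin d) ℂ, A.PosSemidef → B.PosSemidef →
      0 ≤ (hsInner (A ⊗ₖ B) W).re) {σ : Op d} (hσ : σ ∈ separableStates d) :
    0 ≤ (hsInner σ W).re := by
  refine convexHull_min (t := {σ : Op d | 0 ≤ (hsInner σ W).re}) ?_ ?_ hσ
  · rintro _ ⟨A, B, hA, hB, rfl⟩
    exact hW A B hA.1 hB.1
  · refine convex_halfSpace_ge ⟨fun A B => ?_, fun r A => ?_⟩ 0
    · rw [hsInner_add_left, Complex.add_re]
    · rw [hsInner_smul_left, Complex.re_ofReal_mul, smul_eq_mul]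

theorem IsNearestSeparable.hsMeasure_eq {ρ ρ₀ : Op d} (h : IsNearestSeparable ρ ρ₀) :
    hsMeasure ρ = hsNorm (ρ₀ - ρ) := by
  refine IsLeast.csInf_eq ⟨⟨ρ₀, h.1, rfl⟩, ?_⟩
  rintro _ ⟨σ, hσ, rfl⟩
  obtain rfl | hne := eq_or_ne σ ρ₀
  · exact le_rfl
  · exact (h.2 σ hσ hne).le

/-- The cone over the set of separable states: the separable operators without the normalisation
of the trace. -/
noncomputable def separableCone (d : ℕ) : PointedCone ℝ (Op d) :=
  PointedCone.hull ℝ (separableStates d)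

theorem exists_isDensity_smul_eq {ι : Type*} [Fintype ι] {A : Matrix ι ι ℂ} (hA : A.PosSemidef)
    (hA0 : A ≠ 0) : ∃ t : ℝ, 0 < t ∧ ∃ ρ, IsDensity ρ ∧ t • ρ = A := by
  have htr := Complex.le_def.1 hA.trace_nonneg
  have hre : ((A.trace.re : ℝ) : ℂ) = A.trace := Complex.ext rfl htr.2
  have hne : A.trace.re ≠ 0 := fun h => hA0 (hA.trace_eq_zero_iff.1 (by rw [← hre, h]; rfl))
  refine ⟨A.trace.re, htr.1.lt_of_ne' hne, A.trace.re⁻¹ • A, ⟨hA.smul (inv_nonneg.2 htr.1), ?_⟩,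
    smul_inv_smul₀ hne A⟩
  rw [Matrix.trace_smul, ← hre, Complex.ofReal_re, Complex.real_smul, ← Complex.ofReal_mul,
    inv_mul_cancel₀ hne, Complex.ofReal_one]

theorem kronecker_mem_separableCone {A B : Matrix (Fin d) (Fin d) ℂ} (hA : A.PosSemidef)
    (hB : B.PosSemidef) : A ⊗ₖ B ∈ separableCone d := by
  obtain rfl | hA0 := eq_or_ne A 0
  · exact Matrix.zero_kronecker B ▸ zero_mem _
  obtain rfl | hB0 := eq_or_ne B 0
  · exact Matrix.kronecker_zero A ▸ zero_mem _
  obtain ⟨s, hs, ρ, hρ, rfl⟩ := exists_isDensity_smul_eq hA hA0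
  obtain ⟨t, ht, σ, hσ, rfl⟩ := exists_isDensity_smul_eq hB hB0
  have hρσ : ρ ⊗ₖ σ ∈ separableStates d := subset_convexHull ℝ _ ⟨ρ, σ, hρ, hσ, rfl⟩
  rw [Matrix.smul_kronecker, Matrix.kronecker_smul, smul_smul]
  exact PointedCone.smul_mem _ (mul_nonneg hs.le ht.le) (PointedCone.subset_hull hρσ)

theorem eq_zero_or_mem_hull_of_mem_separableCone {X : Op d} (hX : X ∈ separableCone d) :
    X = 0 ∨ X ∈ ConvexCone.hull ℝ (separableStates d) := by
  induction hX using Submodule.span_induction with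
  | mem X hX => exact .inr (ConvexCone.subset_hull hX)
  | zero => exact .inl rfl
  | add X Y _ _ hX hY =>
    obtain rfl | hX := hX
    · rwa [zero_add]
    obtain rfl | hY := hY
    · exact .inr (by rwa [add_zero])
    · exact .inr (add_mem hX hY)
  | smul r X _ hX =>
    obtain rfl | hX := hX
    · exact .inl (smul_zero r)
    obtain rfl | hr := eq_zero_or_pos r
    · exact .inl (zero_smul _ X)
    · exact .inr (ConvexCone.smul_mem _ hr hX)

theorem mem_separableStates_of_mem_separableCone {X : Op d} (hX : X ∈ separableCone d)
    (htr : X.trace = 1) : X ∈ separableStates d := by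
  obtain rfl | hX := eq_zero_or_mem_hull_of_mem_separableCone hX
  · simp at htr
  · obtain ⟨r, -, σ, hσ, rfl⟩ := (ConvexCone.mem_hull_of_convex convex_separableStates).1 hX
    simp only [Matrix.trace_smul, trace_of_mem_separableStates hσ, Complex.real_smul, mul_one,
      Complex.ofReal_eq_one] at htr
    simpa only [htr, one_smul] using hσ

end SeparableStates

section TangentWitness

variable {d : ℕ}

/-- The operator `c 𝟙 + V`, with traceless part `V ≠ 0`, is nonnegative on the separable states and
vanishes at the separable state `ρ₀`. Equivalently, `V` is an inner normal at `ρ₀` of a hyperplane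
supporting the set of separable states. -/
structure IsTangentWitness (c : ℝ) (V ρ₀ : Op d) : Prop where
  isHermitian : V.IsHermitian
  trace_eq_zero : V.trace = 0
  ne_zero : V ≠ 0
  mem_separableStates : ρ₀ ∈ separableStates d
  hsInner_eq_zero : hsInner ρ₀ (c • (1 : Op d) + V) = 0
  re_hsInner_nonneg : ∀ σ ∈ separableStates d, 0 ≤ (hsInner σ (c • (1 : Op d) + V)).re

namespace IsTangentWitness

variable {c t : ℝ} {V ρ ρ₀ : Op d}

theorem hsInner_eq_neg (h : IsTangentWitness c V ρ₀) : hsInner ρ₀ V = -c := by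
  have h0 := h.hsInner_eq_zero
  rw [hsInner_smul_one_add_of_mem_separableStates c h.mem_separableStates] at h0
  exact eq_neg_of_add_eq_zero_right h0

/-- The plane through `ρ₀` orthogonal to `V` separates `ρ` from the separable states, so the angle
at `ρ₀` between `ρ` and any separable state is not acute. -/
theorem isNearestSeparable (h : IsTangentWitness c V ρ₀) (ht : 0 < t) (hρ : ρ₀ - ρ = t • V) :
    IsNearestSeparable ρ ρ₀ := by
  refine ⟨h.mem_separableStates, fun σ hσ hne => ?_⟩
  have hangle : 0 ≤ (hsInner (σ - ρ₀) (ρ₀ - ρ)).re := by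
    have hσV := h.re_hsInner_nonneg σ hσ
    rw [hsInner_smul_one_add_of_mem_separableStates c hσ, add_comm] at hσV
    rw [hρ, hsInner_smul_right, hsInner_sub_left, h.hsInner_eq_neg, sub_neg_eq_add,
      Complex.re_ofReal_mul]
    exact mul_nonneg ht.le hσV
  have hpyth := hsNorm_add_sq (σ - ρ₀) (ρ₀ - ρ)
  rw [sub_add_sub_cancel] at hpyth
  have hpos : 0 < hsNorm (σ - ρ₀) := hsNorm_pos (sub_ne_zero.2 hne)
  exact lt_of_pow_lt_pow_left₀ 2 (Real.sqrt_nonneg _) (by nlinarith)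

theorem hsMeasure_eq (h : IsTangentWitness c V ρ₀) (ht : 0 < t) (hρ : ρ₀ - ρ = t • V) :
    hsMeasure ρ = t * hsNorm V := by
  rw [(h.isNearestSeparable ht hρ).hsMeasure_eq, hρ, hsNorm_smul ht.le]

theorem witnessOp_eq (h : IsTangentWitness c V ρ₀) (ht : 0 < t) (hρ : ρ₀ - ρ = t • V) :
    witnessOp ρ₀ ρ = (hsNorm V)⁻¹ • (c • (1 : Op d) + V) := by
  have hnormal : ρ₀ - ρ - hsInner ρ₀ (ρ₀ - ρ) • (1 : Op d) = t • (c • (1 : Op d) + V) := by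
    rw [hρ, hsInner_smul_right, h.hsInner_eq_neg, ← Complex.ofReal_neg, ← Complex.ofReal_mul,
      Complex.coe_smul]
    module
  rw [witnessOp, hnormal, hρ, hsNorm_smul ht.le, ← Complex.ofReal_inv, Complex.coe_smul, smul_smul,
    mul_inv_rev, inv_mul_cancel_right₀ ht.ne']

theorem hsInner_witnessOp (h : IsTangentWitness c V ρ₀) (ht : 0 < t) (hρ : ρ₀ - ρ = t • V) :
    hsInner ρ (witnessOp ρ₀ ρ) = ((-hsMeasure ρ : ℝ) : ℂ) := by
  have hV : (hsNorm V : ℂ) ≠ 0 := by exact_mod_cast (hsNorm_pos h.ne_zero).ne'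
  have hsplit : hsInner ρ (c • (1 : Op d) + V) = -(t * hsNorm V ^ 2) := by
    rw [← sub_sub_cancel ρ₀ ρ, hρ, hsInner_sub_left, h.hsInner_eq_zero, hsInner_smul_left,
      hsInner_add_right, hsInner_smul_right, hsInner_one_right, h.trace_eq_zero, hsInner_self]
    simp
  rw [h.witnessOp_eq ht hρ, hsInner_smul_right, hsplit, h.hsMeasure_eq ht hρ]
  push_cast
  field_simp

theorem isWitness (h : IsTangentWitness c V ρ₀) (ht : 0 < t) (hρ : ρ₀ - ρ = t • V) :
    IsWitness (witnessOp ρ₀ ρ) ρ := by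
  have hpos := hsNorm_pos h.ne_zero
  refine ⟨?_, ?_, fun σ hσ => ?_⟩
  · rw [h.witnessOp_eq ht hρ]
    exact ((Matrix.isHermitian_one.smul (.all c)).add h.isHermitian).smul (.all _)
  · rw [h.hsInner_witnessOp ht hρ, Complex.ofReal_re, h.hsMeasure_eq ht hρ]
    exact neg_lt_zero.2 (mul_pos ht hpos)
  · rw [h.witnessOp_eq ht hρ, hsInner_smul_right, Complex.re_ofReal_mul]
    exact mul_nonneg (inv_nonneg.2 hpos.le) (h.re_hsInner_nonneg σ hσ)

end IsTangentWitness

end TangentWitness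

section PosSemidef

variable {ι : Type*}

theorem two_mul_abs_re_le_of_posSemidef [Finite ι] {M : Matrix ι ι ℂ} (hM : M.PosSemidef)
    (p q : ι) : 2 * |(M p q).re| ≤ (M p p).re + (M q q).re := by
  classical
  have := Fintype.ofFinite ι
  have hqp : (M q p).re = (M p q).re := by
    rw [← hM.isHermitian.apply p q, Complex.star_def, Complex.conj_re]
  have hform (s : ℝ) : 0 ≤ (M p p).re + 2 * s * (M p q).re + s ^ 2 * (M q q).re := by
    have h := hM.re_dotProduct_nonneg (Pi.single p 1 + Pi.single q (s : ℂ))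
    simp only [star_add, Pi.star_single, star_one, RCLike.star_def, Complex.conj_ofReal,
      Matrix.mulVec_add, Matrix.mulVec_single, MulOpposite.op_one, one_smul, op_smul_eq_smul,
      Complex.coe_smul, dotProduct_add, add_dotProduct, single_dotProduct, Matrix.col_apply,
      one_mul, dotProduct_smul, smul_add, Complex.real_smul, RCLike.re_to_complex, Complex.add_re,
      Complex.mul_re, Complex.ofReal_re, hqp, Complex.ofReal_im, zero_mul, sub_zero, Complex.mul_im,
      add_zero] at h
    linarith
  obtain h | h := abs_cases (M p q).re
  · linarith [hform (-1)]
  · linarith [hform 1]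

variable [Fintype ι]

theorem sum_sum_nonneg_of_posSemidef {R : Type*} [Ring R] [PartialOrder R] [StarRing R]
    {M : Matrix ι ι R} (hM : M.PosSemidef) :
    0 ≤ ∑ i, ∑ j, M i j := by
  simpa [dotProduct, Matrix.mulVec] using hM.dotProduct_mulVec_nonneg 1

theorem sum_diag_le_sum_sum {R : Type*} [CommRing R] [LinearOrder R] [IsStrictOrderedRing R]
    {f : ι → ι → R} (hf : ∀ i j, 0 ≤ f i j + f j i) :
    ∑ i, f i i ≤ ∑ i, ∑ j, f i j := by
  classical
  have hoff : 0 ≤ ∑ i, ∑ j, (f i j + f j i - if i = j then f i j + f j i else 0) := by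
    refine Finset.sum_nonneg fun i _ => Finset.sum_nonneg fun j _ => ?_
    split_ifs
    · rw [sub_self]
    · rw [sub_zero]
      exact hf i j
  have hswap : ∑ i, ∑ j, f j i = ∑ i, ∑ j, f i j := Finset.sum_comm
  simp only [Finset.sum_sub_distrib, Finset.sum_add_distrib, Finset.sum_ite_eq, Finset.mem_univ,
    if_true, hswap] at hoff
  linarith

end PosSemidef

section InvariantOperators

/-- The projector `∑ⱼ |jj⟩⟨jj|`. -/
def diagProj (d : ℕ) : Op d := Matrix.diagonal fun p => if p.1 = p.2 then 1 else 0

/-- The operator `∑ⱼₖ |jj⟩⟨kk|`, which is `d |φ₊⟩⟨φ₊|`. -/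
def diagOnes (d : ℕ) : Op d := Matrix.of fun p q => if p.1 = p.2 ∧ q.1 = q.2 then 1 else 0

variable {d : ℕ}

/-- The operators `x 𝟙 + y ∑ⱼ |jj⟩⟨jj| + z ∑ⱼₖ |jj⟩⟨kk|`: all the operators of the paper belong to
this family, which is invariant under `Θ ⊗ Θ†` for diagonal unitary `Θ`. -/
noncomputable def invariantOp (x y z : ℝ) : Op d :=
  x • (1 : Op d) + y • diagProj d + z • diagOnes d

theorem invariantOp_apply (x y z : ℝ) (i j k l : Fin d) :
    (invariantOp x y z : Op d) (i, j) (k, l) =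
      (if i = k ∧ j = l then (x : ℂ) else 0) + (if i = j ∧ i = k ∧ j = l then (y : ℂ) else 0) +
        if i = j ∧ k = l then (z : ℂ) else 0 := by
  by_cases hij : i = j <;> by_cases hik : i = k <;> by_cases hjl : j = l <;>
    simp [invariantOp, diagProj, diagOnes, Matrix.one_apply, Matrix.diagonal_apply, *]

theorem isHermitian_invariantOp (x y z : ℝ) : (invariantOp x y z : Op d).IsHermitian := by
  refine Matrix.IsHermitian.ext fun ⟨i, j⟩ ⟨k, l⟩ => ?_
  simp only [invariantOp_apply, star_add, apply_ite (star : ℂ → ℂ), Complex.star_def,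
    Complex.conj_ofReal, map_zero]
  grind

theorem hsInner_diagProj_right (A : Op d) :
    hsInner A (diagProj d) = ∑ j, star (A (j, j) (j, j)) := by
  simp [hsInner, diagProj, Matrix.trace, Fintype.sum_prod_type, Matrix.mul_diagonal]

theorem hsInner_diagOnes_right (A : Op d) :
    hsInner A (diagOnes d) = ∑ j, ∑ k, star (A (j, j) (k, k)) := by
  simp only [hsInner, diagOnes, Matrix.trace, Matrix.diag_apply, Matrix.mul_apply,
    Matrix.conjTranspose_apply, Matrix.of_apply, Fintype.sum_prod_type, ite_and, mul_ite, mul_one,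
    mul_zero, Finset.sum_ite_eq, Finset.mem_univ, if_true, Finset.sum_ite_irrel,
    Finset.sum_const_zero]
  exact Finset.sum_comm

theorem hsInner_invariantOp_right (A : Op d) (x y z : ℝ) :
    hsInner A (invariantOp x y z) = x * star A.trace + y * ∑ j, star (A (j, j) (j, j)) +
      z * ∑ j, ∑ k, star (A (j, j) (k, k)) := by
  simp only [invariantOp, hsInner_add_right, hsInner_smul_right, hsInner_one_right,
    hsInner_diagProj_right, hsInner_diagOnes_right]

theorem trace_invariantOp (x y z : ℝ) :
    (invariantOp x y z : Op d).trace = ((d * (d * x + y + z) : ℝ) : ℂ) := by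
  simp only [Matrix.trace, Matrix.diag_apply, Fintype.sum_prod_type, invariantOp_apply, and_self,
    ↓reduceIte, and_true, Finset.sum_add_distrib, Finset.sum_const, Finset.card_univ,
    Fintype.card_fin, nsmul_eq_mul, Finset.sum_ite_eq, Finset.mem_univ, Complex.ofReal_mul,
    Complex.ofReal_natCast, Complex.ofReal_add]
  ring

theorem hsInner_invariantOp (x y z x' y' z' : ℝ) :
    hsInner (invariantOp x y z : Op d) (invariantOp x' y' z') =
      ((d * (x' * (d * x + y + z) + y' * (x + y + z) + z' * (x + y + d * z)) : ℝ) : ℂ) := by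
  rw [hsInner_invariantOp_right, trace_invariantOp]
  simp only [Complex.ofReal_mul, Complex.ofReal_natCast, Complex.ofReal_add, star_mul',
    star_natCast, star_add, RCLike.star_def, Complex.conj_ofReal, invariantOp_apply, and_self,
    ↓reduceIte, Finset.sum_const, Finset.card_univ, Fintype.card_fin, smul_add, nsmul_eq_mul,
    true_and, apply_ite (starRingEnd ℂ), map_zero, Finset.sum_add_distrib, Finset.sum_ite_eq,
    Finset.mem_univ]
  ring

end InvariantOperators

section BlockPositivity

variable {d : ℕ}

/-- The off-diagonal products `A j k * B j k` entering the trace are matrix entries of the partial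
transpose `A ⊗ Bᵀ`, which is positive semidefinite as well. -/
theorem re_hsInner_kronecker_invariantOp_nonneg {s : ℝ} (hs : |s| ≤ 1)
    {A B : Matrix (Fin d) (Fin d) ℂ} (hA : A.PosSemidef) (hB : B.PosSemidef) :
    0 ≤ (hsInner (A ⊗ₖ B) (invariantOp 1 (-(1 + s)) s)).re := by
  set M := A ⊗ₖ Bᵀ with hM
  have hMpos : M.PosSemidef := hA.kronecker hB.transpose
  let f : Fin d → Fin d → ℝ := fun j k => (M (j, k) (j, k)).re + s * (M (j, k) (k, j)).re
  have hsum : ∑ j, f j j ≤ ∑ j, ∑ k, f j k := by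
    refine sum_diag_le_sum_sum fun j k => ?_
    have hjk := two_mul_abs_re_le_of_posSemidef hMpos (j, k) (k, j)
    have hkj : (M (k, j) (j, k)).re = (M (j, k) (k, j)).re := by
      rw [← hMpos.isHermitian.apply, Complex.star_def, Complex.conj_re]
    have hs' : |s * (M (j, k) (k, j)).re| ≤ |(M (j, k) (k, j)).re| := by
      rw [abs_mul]
      exact mul_le_of_le_one_left (abs_nonneg _) hs
    have := neg_abs_le (s * (M (j, k) (k, j)).re)
    simp only [f, hkj]
    linarith
  have hform : (hsInner (A ⊗ₖ B) (invariantOp 1 (-(1 + s)) s)).re =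
      ∑ j, ∑ k, f j k - ∑ j, f j j := by
    rw [hsInner_invariantOp_right]
    simp only [hM, f, Complex.ofReal_one, Matrix.trace, Matrix.diag_apply,
      Matrix.kroneckerMap_apply, Matrix.transpose_apply, Fintype.sum_prod_type, star_sum, star_mul',
      RCLike.star_def, Finset.mul_sum, one_mul, neg_add_rev, Complex.ofReal_add, Complex.ofReal_neg,
      add_mul, neg_mul, Finset.sum_add_distrib, Finset.sum_neg_distrib, Complex.add_re,
      Complex.re_sum, Complex.mul_re, Complex.conj_re, Complex.conj_im, mul_neg, neg_neg,
      Finset.sum_sub_distrib, Complex.neg_re, Complex.ofReal_re, Complex.ofReal_im, Complex.mul_im,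
      zero_mul, sub_zero, neg_sub]
    ring
  rw [hform]
  exact sub_nonneg.2 hsum

theorem re_hsInner_invariantOp_nonneg {s : ℝ} (hs : |s| ≤ 1) {σ : Op d}
    (hσ : σ ∈ separableStates d) : 0 ≤ (hsInner σ (invariantOp 1 (-(1 + s)) s)).re :=
  re_hsInner_nonneg_of_mem_separableStates
    (fun _ _ => re_hsInner_kronecker_invariantOp_nonneg hs) hσ

end BlockPositivity

section Positivity

variable {d : ℕ}

theorem posSemidef_diagProj : (diagProj d).PosSemidef :=
  Matrix.PosSemidef.diagonal fun p => by dsimp only; split_ifs <;> simp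

theorem posSemidef_one_sub_diagProj : (1 - diagProj d).PosSemidef := by
  rw [diagProj, ← Matrix.diagonal_one, Matrix.diagonal_sub]
  exact Matrix.PosSemidef.diagonal fun p => by dsimp only; split_ifs <;> simp

theorem diagOnes_mul_self : diagOnes d * diagOnes d = (d : ℝ) • diagOnes d := by
  ext ⟨i, j⟩ ⟨k, l⟩
  simp [diagOnes, Matrix.mul_apply, Fintype.sum_prod_type, ite_and, mul_comm]

theorem posSemidef_diagOnes : (diagOnes d).PosSemidef := by
  let v : Fin d × Fin d → ℂ := fun p => if p.1 = p.2 then 1 else 0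
  have hv : diagOnes d = Matrix.vecMulVec v (star v) := by
    ext p q
    by_cases hp : p.1 = p.2 <;>
      simp [diagOnes, v, Matrix.vecMulVec_apply, apply_ite (starRingEnd ℂ), hp]
  exact hv ▸ Matrix.posSemidef_vecMulVec_self_star v

theorem diagProj_mul_diagOnes : diagProj d * diagOnes d = diagOnes d := by
  ext ⟨i, j⟩ ⟨k, l⟩
  by_cases hij : i = j <;> simp [diagProj, diagOnes, hij]

theorem diagOnes_mul_diagProj : diagOnes d * diagProj d = diagOnes d := by
  ext ⟨i, j⟩ ⟨k, l⟩
  by_cases hkl : k = l <;> simp [diagProj, diagOnes, hkl]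

theorem diagProj_mul_self : diagProj d * diagProj d = diagProj d := by
  simp [diagProj, Matrix.diagonal_mul_diagonal]

/-- `diagOnes d / d` is a projector whose range is contained in that of `diagProj d`. -/
theorem posSemidef_diagProj_sub_diagOnes (hd : d ≠ 0) :
    (diagProj d - (d : ℝ)⁻¹ • diagOnes d).PosSemidef := by
  set P := diagProj d - (d : ℝ)⁻¹ • diagOnes d with hP
  have hherm : P.IsHermitian :=
    posSemidef_diagProj.isHermitian.sub (posSemidef_diagOnes.isHermitian.smul (.all _))
  have hmul : P * P = P := by
    simp [hP, sub_mul, mul_sub, diagOnes_mul_self, diagProj_mul_self, diagProj_mul_diagOnes,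
      diagOnes_mul_diagProj, smul_smul, hd]
  rw [← hmul]
  nth_rw 1 [← hherm.eq]
  exact Matrix.posSemidef_conjTranspose_mul_self P

theorem nonneg_of_posSemidef_invariantOp (hd : 1 < d) {x y z : ℝ}
    (h : (invariantOp x y z : Op d).PosSemidef) : 0 ≤ x ∧ 0 ≤ x + y ∧ 0 ≤ x + y + d * z := by
  let i : Fin d := ⟨0, by lia⟩
  let j : Fin d := ⟨1, hd⟩
  have hij : i ≠ j := by simp [i, j]
  refine ⟨?_, ?_, ?_⟩
  · simpa [invariantOp_apply, hij] using h.diag_nonneg (i := (i, j))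
  · have h2 := two_mul_abs_re_le_of_posSemidef h (i, i) (j, j)
    simp only [invariantOp_apply, hij] at h2
    norm_num at h2
    linarith [le_abs_self z]
  · have hsum : ∑ j, ∑ k, (invariantOp x y z : Op d) (j, j) (k, k) =
        ((d * (x + y + d * z) : ℝ) : ℂ) := by
      simp only [invariantOp_apply, and_self, true_and, ↓reduceIte, Finset.sum_add_distrib,
        Finset.sum_ite_eq, Finset.mem_univ, Finset.sum_const, Finset.card_univ, Fintype.card_fin,
        nsmul_eq_mul, Complex.ofReal_mul, Complex.ofReal_natCast, Complex.ofReal_add]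
      ring
    have h3 := sum_sum_nonneg_of_posSemidef (h.submatrix fun j => (j, j))
    simp only [Matrix.submatrix_apply, hsum, Complex.zero_le_real] at h3
    exact (mul_nonneg_iff_of_pos_left (by positivity)).1 h3

theorem posSemidef_invariantOp_iff (hd : 1 < d) {x y z : ℝ} :
    (invariantOp x y z : Op d).PosSemidef ↔ 0 ≤ x ∧ 0 ≤ x + y ∧ 0 ≤ x + y + d * z := by
  refine ⟨nonneg_of_posSemidef_invariantOp hd, fun ⟨hx, hxy, hxyz⟩ => ?_⟩
  have hd0 : (d : ℝ) ≠ 0 := by positivity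
  have hsplit : invariantOp x y z = x • (1 - diagProj d) +
      (x + y) • (diagProj d - (d : ℝ)⁻¹ • diagOnes d) + ((x + y + d * z) / d) • diagOnes d := by
    rw [invariantOp]
    match_scalars <;> field_simp <;> ring
  rw [hsplit]
  exact ((posSemidef_one_sub_diagProj.smul hx).add
    ((posSemidef_diagProj_sub_diagOnes (by lia)).smul hxy)).add
    (posSemidef_diagOnes.smul (by positivity))

end Positivity

section PhaseTwirl

variable {d : ℕ}

theorem sum_stdAddChar_sub_sub_add (i j k l : Fin d) :
    ∑ a : Fin d → ZMod 3, ZMod.stdAddChar (a i - a k - (a j - a l)) =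
      if i = k ∧ j = l ∨ i = j ∧ k = l then (3 ^ d : ℂ) else 0 := by
  let ev (m : Fin d) : (Fin d → ZMod 3) →+ ZMod 3 := Pi.evalAddMonoidHom _ m
  let f : (Fin d → ZMod 3) →+ ZMod 3 := ev i - ev k - (ev j - ev l)
  let ψ : AddChar (Fin d → ZMod 3) ℂ := ZMod.stdAddChar.compAddMonoidHom f
  have hψ : ψ = 0 ↔ i = k ∧ j = l ∨ i = j ∧ k = l := by
    constructor
    · intro h
      have hf (m : Fin d) : f (Pi.single m 1) = 0 := by
        refine ZMod.injective_stdAddChar ?_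
        rw [AddChar.map_zero_eq_one]
        exact DFunLike.congr_fun h _
      have hi := hf i
      have hj := hf j
      have hl := hf l
      simp only [f, ev, AddMonoidHom.sub_apply, Pi.evalAddMonoidHom_apply, Pi.single_apply]
        at hi hj hl
      grind
    · intro h
      have hf : f = 0 := by
        ext a
        rcases h with ⟨rfl, rfl⟩ | ⟨rfl, rfl⟩ <;> simp [f]
      ext a
      simp [ψ, hf]
  have hsum := AddChar.sum_eq_ite ψ
  simpa [hψ, ψ, f, ev] using hsum

/-- The average of `(Θ ⊗ Θ†) X (Θ ⊗ Θ†)†` over the diagonal unitaries `Θ`: it keeps the matrix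
entries `⟨ij|X|kl⟩` on which the phases cancel. -/
def phaseTwirl (X : Op d) : Op d :=
  Matrix.of fun p q => if p.1 = q.1 ∧ p.2 = q.2 ∨ p.1 = p.2 ∧ q.1 = q.2 then X p q else 0

theorem phaseTwirl_kronecker_mem_separableCone {A B : Matrix (Fin d) (Fin d) ℂ}
    (hA : A.PosSemidef) (hB : B.PosSemidef) : phaseTwirl (A ⊗ₖ B) ∈ separableCone d := by
  let Θ (a : Fin d → ZMod 3) : Matrix (Fin d) (Fin d) ℂ :=
    Matrix.diagonal fun i => ZMod.stdAddChar (a i)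
  let X (a : Fin d → ZMod 3) : Op d := (Θ a * A * (Θ a)ᴴ) ⊗ₖ (Θ (-a) * B * (Θ (-a))ᴴ)
  have hX (a) : X a ∈ separableCone d :=
    kronecker_mem_separableCone (hA.mul_mul_conjTranspose_same _) (hB.mul_mul_conjTranspose_same _)
  have hentry (a) (i j k l : Fin d) :
      X a (i, j) (k, l) = ZMod.stdAddChar (a i - a k - (a j - a l)) * (A i k * B j l) := by
    simp only [X, Θ, Matrix.diagonal_conjTranspose, Matrix.kroneckerMap_apply, Matrix.mul_diagonal,
      Matrix.diagonal_mul, Pi.neg_apply, Pi.star_apply, RCLike.star_def, sub_eq_add_neg,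
      neg_add_rev, neg_neg, AddChar.map_add_eq_mul, AddChar.map_neg_eq_conj,
      RingHomCompTriple.comp_apply, RingHom.id_apply]
    ring
  have hmean : phaseTwirl (A ⊗ₖ B) = (3 ^ d : ℝ)⁻¹ • ∑ a, X a := by
    ext ⟨i, j⟩ ⟨k, l⟩
    simp only [Matrix.smul_apply, Matrix.sum_apply, hentry, ← Finset.sum_mul,
      sum_stdAddChar_sub_sub_add, phaseTwirl, Matrix.of_apply]
    split_ifs <;> simp
  rw [hmean]
  exact PointedCone.smul_mem _ (by positivity) (sum_mem fun a _ => hX a)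

end PhaseTwirl

section Separability

variable {d : ℕ}

theorem diagonal_mem_separableCone {f : Fin d × Fin d → ℂ} (hf : 0 ≤ f) :
    Matrix.diagonal f ∈ separableCone d := by
  let e (i : Fin d) : Matrix (Fin d) (Fin d) ℂ := Matrix.diagonal (Pi.single i 1)
  have he (i) : (e i).PosSemidef := Matrix.PosSemidef.diagonal (Pi.single_nonneg.2 zero_le_one)
  have hsum : Matrix.diagonal f = ∑ p, (f p • e p.1) ⊗ₖ e p.2 := by
    ext ⟨i, j⟩ ⟨k, l⟩
    by_cases hik : i = k <;> by_cases hjl : j = l <;>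
      simp [e, Matrix.sum_apply, Fintype.sum_prod_type, Pi.single_apply, *]
  rw [hsum]
  exact sum_mem fun p _ => kronecker_mem_separableCone ((he p.1).smul (hf p)) (he p.2)

theorem diagProj_mem_separableCone : diagProj d ∈ separableCone d :=
  diagonal_mem_separableCone fun p => by dsimp only [Pi.zero_apply]; split_ifs <;> simp

theorem one_sub_diagProj_mem_separableCone : 1 - diagProj d ∈ separableCone d := by
  rw [diagProj, ← Matrix.diagonal_one, Matrix.diagonal_sub]
  exact diagonal_mem_separableCone fun p => by dsimp only [Pi.zero_apply]; split_ifs <;> simp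

theorem one_sub_diagProj_add_diagOnes_mem_separableCone :
    1 - diagProj d + diagOnes d ∈ separableCone d := by
  have hpos : (Matrix.vecMulVec 1 (star 1) : Matrix (Fin d) (Fin d) ℂ).PosSemidef :=
    Matrix.posSemidef_vecMulVec_self_star _
  have htwirl : 1 - diagProj d + diagOnes d =
      phaseTwirl (Matrix.vecMulVec 1 (star 1) ⊗ₖ Matrix.vecMulVec 1 (star 1)) := by
    ext ⟨i, j⟩ ⟨k, l⟩
    simp only [diagProj, diagOnes, phaseTwirl, Matrix.add_apply, Matrix.sub_apply, Matrix.one_apply,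
      Prod.mk.injEq, Matrix.diagonal_apply, Matrix.of_apply, Matrix.kroneckerMap_apply,
      Matrix.vecMulVec_apply, star_one, Pi.one_apply, mul_one]
    grind
  exact htwirl ▸ phaseTwirl_kronecker_mem_separableCone hpos hpos

/-- The twirls of the products of `|p⟩ + |q⟩` with `|p⟩ - |q⟩` add up to twice this operator. -/
theorem one_add_smul_diagProj_sub_diagOnes_mem_separableCone :
    1 + (d - 1 : ℝ) • diagProj d - diagOnes d ∈ separableCone d := by
  let u (p q : Fin d) : Fin d → ℂ := Pi.single p 1 + Pi.single q 1
  let v (p q : Fin d) : Fin d → ℂ := Pi.single p 1 - Pi.single q 1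
  have hsum : 1 + (d - 1 : ℝ) • diagProj d - diagOnes d =
      (2 : ℝ)⁻¹ • ∑ p, ∑ q, phaseTwirl (Matrix.vecMulVec (u p q) (star (u p q)) ⊗ₖ
        Matrix.vecMulVec (v p q) (star (v p q))) := by
    ext ⟨i, j⟩ ⟨k, l⟩
    simp only [diagProj, diagOnes, phaseTwirl, u, v, Matrix.sub_apply, Matrix.add_apply,
      Matrix.one_apply, Prod.mk.injEq, Matrix.smul_apply, Matrix.diagonal_apply, smul_ite,
      Complex.real_smul, Complex.ofReal_sub, Complex.ofReal_natCast, Complex.ofReal_one, smul_zero,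
      Matrix.of_apply, star_add, star_sub, star_one, Pi.star_single, Matrix.kroneckerMap_apply,
      Matrix.vecMulVec_apply, Pi.add_apply, Pi.sub_apply, Pi.single_apply, mul_add, mul_sub,
      mul_ite, mul_one, mul_zero, Matrix.sum_apply, Finset.sum_ite_irrel, Finset.sum_sub_distrib,
      Finset.sum_add_distrib, Finset.sum_const, Finset.card_univ, Fintype.card_fin, nsmul_eq_mul,
      Finset.sum_ite_eq, Finset.mem_univ, if_true, Complex.ofReal_inv, Complex.ofReal_ofNat]
    grind
  rw [hsum]
  exact PointedCone.smul_mem _ (by norm_num) (sum_mem fun p _ => sum_mem fun q _ =>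
    phaseTwirl_kronecker_mem_separableCone (Matrix.posSemidef_vecMulVec_self_star _)
      (Matrix.posSemidef_vecMulVec_self_star _))

theorem invariantOp_mem_separableCone {x y z : ℝ} (hz : |z| ≤ x) (hxy : 0 ≤ x + y)
    (hxyz : 0 ≤ x + y + d * z) : (invariantOp x y z : Op d) ∈ separableCone d := by
  obtain ⟨hxz, hzx⟩ := abs_le.1 hz
  obtain hz0 | hz0 := le_total 0 z
  · have hsplit : (invariantOp x y z : Op d) = z • (1 - diagProj d + diagOnes d) +
        (x - z) • (1 - diagProj d) + (x + y) • diagProj d := by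
      rw [invariantOp]
      module
    rw [hsplit]
    exact add_mem (add_mem
      (PointedCone.smul_mem _ hz0 one_sub_diagProj_add_diagOnes_mem_separableCone)
      (PointedCone.smul_mem _ (by linarith) one_sub_diagProj_mem_separableCone))
      (PointedCone.smul_mem _ hxy diagProj_mem_separableCone)
  · have hsplit : (invariantOp x y z : Op d) =
        (-z) • (1 + (d - 1 : ℝ) • diagProj d - diagOnes d) +
          (x + z) • (1 - diagProj d) + (x + y + d * z) • diagProj d := by
      rw [invariantOp]
      module
    rw [hsplit]
    exact add_mem (add_mem
      (PointedCone.smul_mem _ (by linarith) one_add_smul_diagProj_sub_diagOnes_mem_separableCone)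
      (PointedCone.smul_mem _ (by linarith) one_sub_diagProj_mem_separableCone))
      (PointedCone.smul_mem _ hxyz diagProj_mem_separableCone)

end Separability

section EntangledInvariantOperators

variable {d : ℕ} {s x y z : ℝ}

theorem invariantOp_mem_separableStates (hd : 1 < d) (h : IsDensity (invariantOp x y z : Op d))
    (hz : |z| ≤ x) : (invariantOp x y z : Op d) ∈ separableStates d := by
  obtain ⟨-, hxy, hxyz⟩ := (posSemidef_invariantOp_iff hd).1 h.1
  exact mem_separableStates_of_mem_separableCone (invariantOp_mem_separableCone hz hxy hxyz) h.2

theorem abs_le_of_invariantOp_mem_separableStates (hd : 1 < d)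
    (h : (invariantOp x y z : Op d) ∈ separableStates d) : |z| ≤ x := by
  have hd' : (1 : ℝ) < d := by exact_mod_cast hd
  have hxz {s : ℝ} (hs : |s| ≤ 1) : 0 ≤ x + s * z := by
    have hinner := re_hsInner_invariantOp_nonneg hs h
    rw [hsInner_invariantOp, Complex.ofReal_re] at hinner
    have hpos : (0 : ℝ) < d * (d - 1) := mul_pos (by linarith) (by linarith)
    refine (mul_nonneg_iff_of_pos_left hpos).1 (hinner.trans_eq ?_)
    ring
  rw [abs_le]
  constructor
  · linarith [hxz (s := 1) (by simp)]
  · linarith [hxz (s := -1) (by simp)]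

theorem isEntangled_invariantOp_iff (hd : 1 < d) :
    IsEntangled (invariantOp x y z : Op d) ↔ IsDensity (invariantOp x y z : Op d) ∧ x < |z| := by
  refine and_congr_right fun h => ?_
  rw [← not_le]
  exact not_congr ⟨abs_le_of_invariantOp_mem_separableStates hd,
    invariantOp_mem_separableStates hd h⟩

/-- The inner normal of the hyperplane `x + s z = 0` supporting the separable operators
`x 𝟙 + y D + z J`: the traceless part of `d (𝟙 - (1 + s) D + s J)`. -/
noncomputable def supportingNormal (s : ℝ) : Op d :=
  invariantOp 1 (-(d * (1 + s))) (d * s)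

theorem smul_one_add_supportingNormal :
    (d - 1 : ℝ) • (1 : Op d) + supportingNormal s = (d : ℝ) • invariantOp 1 (-(1 + s)) s := by
  simp only [supportingNormal, invariantOp]
  module

theorem trace_supportingNormal : (supportingNormal s : Op d).trace = 0 := by
  rw [supportingNormal, trace_invariantOp, Complex.ofReal_eq_zero]
  ring

theorem hsNorm_supportingNormal :
    hsNorm (supportingNormal s : Op d) = d * √((d - 1) * (1 + d * s ^ 2)) := by
  have hinner : (hsInner (supportingNormal s : Op d) (supportingNormal s)).re =
      d ^ 2 * ((d - 1) * (1 + d * s ^ 2)) := by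
    rw [supportingNormal, hsInner_invariantOp, Complex.ofReal_re]
    ring
  rw [hsNorm, hinner, Real.sqrt_mul (sq_nonneg _), Real.sqrt_sq (Nat.cast_nonneg d)]

theorem supportingNormal_ne_zero (hd : 1 < d) : (supportingNormal s : Op d) ≠ 0 := by
  have hd' : 0 < (d : ℝ) - 1 := sub_pos.2 (by exact_mod_cast hd)
  have hpos : 0 < d * √((d - 1) * (1 + d * s ^ 2)) := by positivity
  intro h0
  rw [← hsNorm_supportingNormal, h0] at hpos
  simp [hsNorm, hsInner] at hpos

theorem isTangentWitness_supportingNormal (hd : 1 < d) (hs : |s| ≤ 1)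
    (h : (invariantOp x y z : Op d) ∈ separableStates d) (hxz : x + s * z = 0) :
    IsTangentWitness (d - 1) (supportingNormal s) (invariantOp x y z : Op d) where
  isHermitian := isHermitian_invariantOp _ _ _
  trace_eq_zero := trace_supportingNormal
  ne_zero := supportingNormal_ne_zero hd
  mem_separableStates := h
  hsInner_eq_zero := by
    rw [smul_one_add_supportingNormal, hsInner_smul_right, hsInner_invariantOp,
      ← Complex.ofReal_mul, Complex.ofReal_eq_zero]
    linear_combination (d : ℝ) ^ 2 * (d - 1) * hxz
  re_hsInner_nonneg σ hσ := by
    rw [smul_one_add_supportingNormal, hsInner_smul_right, Complex.re_ofReal_mul]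
    exact mul_nonneg (Nat.cast_nonneg d) (re_hsInner_invariantOp_nonneg hs hσ)

end EntangledInvariantOperators

section WeylAndBellOperators

variable {d : ℕ}

theorem bell_apply (n m i j k l : Fin d) :
    bell n m (i, j) (k, l) = weyl n m i j * star (weyl n m k l) / d := by
  have hphi (i j : Fin d) : ((weyl n m ⊗ₖ (1 : Matrix (Fin d) (Fin d) ℂ)) *ᵥ phiPlus d) (i, j) =
      weyl n m i j / √d := by
    simp [Matrix.mulVec, dotProduct, Fintype.sum_prod_type, phiPlus, Matrix.one_apply,
      div_eq_mul_inv]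
  have hbell : bell n m = Matrix.vecMulVec ((weyl n m ⊗ₖ 1) *ᵥ phiPlus d)
      (star ((weyl n m ⊗ₖ 1) *ᵥ phiPlus d)) := by
    rw [bell, Matrix.mul_vecMulVec, Matrix.vecMulVec_mul, Matrix.star_mulVec,
      Matrix.conjTranspose_kronecker, Matrix.conjTranspose_one]
  have hd : (√d : ℂ) * √d = d := by
    rw [← Complex.ofReal_mul, Real.mul_self_sqrt (Nat.cast_nonneg d), Complex.ofReal_natCast]
  rw [hbell, Matrix.vecMulVec_apply, Pi.star_apply, hphi, hphi, star_div₀, Complex.star_def,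
    Complex.conj_ofReal, div_mul_div_comm, hd]

variable [NeZero d]

/-- The phase `e^{2πi kn/d}`. -/
noncomputable def phase (k n : Fin d) : ℂ :=
  ZMod.stdAddChar (k.val * n.val : ZMod d)

theorem weyl_apply (n m k l : Fin d) : weyl n m k l = if l = k + m then phase k n else 0 := by
  have hexp : Complex.exp (2 * Real.pi * Complex.I / d * (k.val * n.val)) = phase k n := by
    have h := ZMod.stdAddChar_coe (N := d) (k.val * n.val : ℤ)
    push_cast at h
    rw [phase, h]
    congr 1
    ring
  rw [weyl, Matrix.of_apply, hexp]

theorem phase_neg (k n : Fin d) : phase k (-n) = star (phase k n) := by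
  have hval : ((-n).val : ZMod d) = -(n.val : ZMod d) := by
    rw [Fin.val_neg', ZMod.natCast_mod, Nat.cast_sub n.is_lt.le, ZMod.natCast_self, zero_sub]
  rw [phase, phase, hval, mul_neg, AddChar.map_neg_eq_conj, Complex.star_def]

theorem sum_phase_mul_star_phase (i k : Fin d) :
    ∑ n, phase i n * star (phase k n) = if i = k then (d : ℂ) else 0 := by
  have hterm (n : Fin d) : phase i n * star (phase k n) =
      ZMod.stdAddChar ((n.val : ZMod d) * (i.val - k.val : ZMod d)) := by
    rw [phase, phase, Complex.star_def, ← AddChar.map_neg_eq_conj, ← AddChar.map_add_eq_mul]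
    ring_nf
  have hik : (i.val - k.val : ZMod d) = 0 ↔ i = k := by
    rw [sub_eq_zero, ZMod.natCast_eq_natCast_iff', Nat.mod_eq_of_lt i.is_lt,
      Nat.mod_eq_of_lt k.is_lt, Fin.val_inj]
  let e : Fin d ≃ ZMod d :=
    ⟨fun n => n.val, fun a => ⟨a.val, a.val_lt⟩, fun n => Fin.ext (ZMod.val_cast_of_lt n.is_lt),
      ZMod.natCast_zmod_val⟩
  calc ∑ n, phase i n * star (phase k n)
    _ = ∑ a : ZMod d, ZMod.stdAddChar (a * (i.val - k.val : ZMod d)) :=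
      Fintype.sum_equiv e _ _ hterm
    _ = if i = k then (d : ℂ) else 0 := by
      rw [AddChar.sum_mulShift _ (ZMod.isPrimitive_stdAddChar d), ZMod.card, Nat.cast_ite,
        Nat.cast_zero, if_congr hik rfl rfl]

theorem sum_weyl_kronecker_weyl_neg_apply (m i j k l : Fin d) :
    (∑ n : Fin d, weyl n m ⊗ₖ weyl (-n) m) (i, j) (k, l) =
      if i = j ∧ k = i + m ∧ l = j + m then (d : ℂ) else 0 := by
  simp only [Matrix.sum_apply, Matrix.kroneckerMap_apply, weyl_apply, phase_neg]
  by_cases hk : k = i + m <;> by_cases hl : l = j + m <;>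
    simp [hk, hl, ← sum_phase_mul_star_phase]

theorem sum_weyl_zero_kronecker_weyl_neg_zero :
    ∑ n : Fin d, weyl n 0 ⊗ₖ weyl (-n) 0 = (d : ℝ) • diagProj d := by
  ext ⟨i, j⟩ ⟨k, l⟩
  rw [sum_weyl_kronecker_weyl_neg_apply]
  simp only [add_zero, diagProj, Matrix.smul_apply, Matrix.diagonal_apply, Prod.mk.injEq, smul_ite,
    smul_zero, Complex.real_smul, Complex.ofReal_natCast, mul_one]
  grind

theorem sum_sum_weyl_kronecker_weyl_neg :
    ∑ m : Fin d, ∑ n : Fin d, weyl n m ⊗ₖ weyl (-n) m = (d : ℝ) • diagOnes d := by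
  ext ⟨i, j⟩ ⟨k, l⟩
  have hm (m : Fin d) : k = i + m ↔ m = k - i := by rw [eq_sub_iff_add_eq', eq_comm]
  rw [Matrix.sum_apply]
  simp only [sum_weyl_kronecker_weyl_neg_apply, hm, ite_and, Finset.sum_ite_irrel,
    Finset.sum_ite_eq', Finset.mem_univ, if_true, Finset.sum_const_zero, diagOnes,
    Matrix.smul_apply, Matrix.of_apply, smul_ite, smul_zero, Complex.real_smul,
    Complex.ofReal_natCast, mul_one]
  refine if_ctx_congr Iff.rfl (fun hij => ?_) fun _ => rfl
  rw [hij, add_sub_cancel]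
  exact if_congr eq_comm rfl rfl

theorem bell_zero_zero : (bell 0 0 : Op d) = (d : ℝ)⁻¹ • diagOnes d := by
  ext ⟨i, j⟩ ⟨k, l⟩
  by_cases hij : i = j <;>
    simp [bell_apply, weyl_apply, phase, diagOnes, div_eq_mul_inv, eq_comm, hij]

theorem sum_bell_zero : ∑ n : Fin d, bell n 0 = diagProj d := by
  ext ⟨i, j⟩ ⟨k, l⟩
  have hd : (d : ℂ) ≠ 0 := NeZero.ne _
  simp only [Matrix.sum_apply, bell_apply, weyl_apply, add_zero, apply_ite star, star_zero, mul_ite,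
    ite_mul, mul_zero, zero_mul, ← Finset.sum_div, Finset.sum_ite_irrel, Finset.sum_const_zero,
    sum_phase_mul_star_phase, diagProj, Matrix.diagonal_apply, Prod.mk.injEq]
  grind

end WeylAndBellOperators

section TwoQutrits

theorem weylPair_zero_zero : weylPair 0 0 = 1 := by
  have hweyl : (weyl 0 0 : Matrix (Fin 3) (Fin 3) ℂ) = 1 := by
    ext k l
    simp [weyl_apply, phase, Matrix.one_apply, eq_comm]
  rw [weylPair, neg_zero, hweyl, Matrix.one_kronecker_one]

theorem opU_eq_invariantOp : opU = invariantOp (-1) 0 3 := by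
  have hsum : ∑ p : Fin 3 × Fin 3, weylPair p.1 p.2 = (3 : ℝ) • diagOnes 3 := by
    rw [Fintype.sum_prod_type, Finset.sum_comm]
    exact sum_sum_weyl_kronecker_weyl_neg
  rw [opU, Finset.sum_erase_eq_sub (Finset.mem_univ _), hsum, weylPair_zero_zero, invariantOp]
  module

theorem opU₂_eq_invariantOp : opU₂ = invariantOp (-1) 3 0 := by
  have hsum : weylPair 0 0 + weylPair 1 0 + weylPair 2 0 = (3 : ℝ) • diagProj 3 := by
    rw [← Fin.sum_univ_three fun n => weylPair n 0]
    exact sum_weyl_zero_kronecker_weyl_neg_zero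
  rw [weylPair_zero_zero, add_assoc] at hsum
  rw [opU₂, eq_sub_of_add_eq' hsum, invariantOp]
  module

theorem opU_eq_add : opU = opU₁ + opU₂ := by
  rw [opU, Finset.sum_erase_eq_sub (Finset.mem_univ _), Fintype.sum_prod_type]
  simp only [Fin.sum_univ_three, opU₁, opU₂]
  abel

theorem opU₁_eq_invariantOp : opU₁ = invariantOp 0 (-3) 3 := by
  rw [eq_sub_of_add_eq opU_eq_add.symm, opU_eq_invariantOp, opU₂_eq_invariantOp]
  simp only [invariantOp]
  module

theorem rho_eq_invariantOp (α β : ℝ) :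
    rho α β = invariantOp ((1 - α - β) / 9) (β / 2) ((α - β / 2) / 3) := by
  have hbell : bell 1 0 + bell 2 0 = diagProj 3 - (3 : ℝ)⁻¹ • diagOnes 3 := by
    have hsum := sum_bell_zero (d := 3)
    rw [Fin.sum_univ_three, bell_zero_zero, add_assoc] at hsum
    exact eq_sub_of_add_eq' hsum
  rw [rho, hbell, bell_zero_zero, invariantOp]
  match_scalars <;> ring

theorem bloch_eq_invariantOp (a b : ℝ) :
    bloch a b = invariantOp ((1 - b) / 9) ((b - a) / 3) (a / 3) := by
  rw [bloch, opU₁_eq_invariantOp, opU₂_eq_invariantOp]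
  simp only [invariantOp]
  module

theorem rho_eq_bloch (α β : ℝ) : rho α β = bloch (α - β / 2) (α + β) := by
  rw [rho_eq_invariantOp, bloch_eq_invariantOp]
  congr 1 <;> ring

theorem trace_rho (α β : ℝ) : (rho α β).trace = 1 := by
  rw [rho_eq_invariantOp, trace_invariantOp, ← Complex.ofReal_one]
  congr 1
  push_cast
  ring

theorem isDensity_rho_iff {α β : ℝ} :
    IsDensity (rho α β) ↔ α ≤ -β + 1 ∧ 1 / 8 * β - 1 / 8 ≤ α ∧ α ≤ 7 / 2 * β + 1 := by
  rw [IsDensity, and_iff_left (trace_rho α β), rho_eq_invariantOp,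
    posSemidef_invariantOp_iff (by norm_num)]
  push_cast
  constructor <;> rintro ⟨h₁, h₂, h₃⟩ <;> refine ⟨?_, ?_, ?_⟩ <;> linarith

theorem rho_mem_separableStates {α β : ℝ} (h : IsDensity (rho α β))
    (hz : |α - β / 2| ≤ (1 - α - β) / 3) : rho α β ∈ separableStates 3 := by
  rw [rho_eq_invariantOp] at h ⊢
  refine invariantOp_mem_separableStates (by norm_num) h ?_
  rw [abs_div, abs_of_pos (three_pos : (0 : ℝ) < 3)]
  linarith

theorem isEntangled_rho_iff {α β : ℝ} :
    IsEntangled (rho α β) ↔ RegionI α β ∨ RegionII α β := by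
  have habs : (1 - α - β) / 9 < |(α - β / 2) / 3| ↔ β / 8 + 1 / 4 < α ∨ α < 5 / 4 * β - 1 / 2 := by
    rw [lt_abs]
    refine or_congr ?_ ?_ <;> constructor <;> intro h <;> linarith
  have hentangled := isEntangled_invariantOp_iff (d := 3) (x := (1 - α - β) / 9) (y := β / 2)
    (z := (α - β / 2) / 3) (by norm_num)
  rw [← rho_eq_invariantOp, isDensity_rho_iff, habs] at hentangled
  rw [hentangled, RegionI, RegionII]
  constructor
  · rintro ⟨⟨htop, hbottom, hleft⟩, hI | hII⟩
    · exact .inl ⟨hleft, htop, hI⟩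
    · exact .inr ⟨hII, hbottom, htop⟩
  · rintro (⟨hleft, htop, hI⟩ | ⟨hII, hbottom, htop⟩)
    · exact ⟨⟨htop, by linarith, hleft⟩, .inl hI⟩
    · exact ⟨⟨htop, hbottom, by linarith⟩, .inr hII⟩

theorem neg_opU_eq_supportingNormal : -opU = supportingNormal (-1) := by
  rw [opU_eq_invariantOp]
  simp only [supportingNormal, invariantOp]
  match_scalars <;> norm_num

theorem opU₁_sub_opU₂_eq_supportingNormal : opU₁ - opU₂ = supportingNormal 1 := by
  rw [opU₁_eq_invariantOp, opU₂_eq_invariantOp]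
  simp only [supportingNormal, invariantOp]
  match_scalars <;> norm_num

theorem hsNorm_supportingNormal_three {s : ℝ} (hs : s ^ 2 = 1) :
    hsNorm (supportingNormal s : Op 3) = 6 * √2 := by
  have hroot : ((3 : ℕ) - 1 : ℝ) * (1 + (3 : ℕ) * 1) = 2 ^ 2 * 2 := by norm_num
  rw [hsNorm_supportingNormal, hs, hroot, Real.sqrt_mul (sq_nonneg 2), Real.sqrt_sq zero_le_two]
  push_cast
  ring

theorem hsNorm_neg_opU : hsNorm (-opU) = 6 * √2 := by
  rw [neg_opU_eq_supportingNormal, hsNorm_supportingNormal_three neg_one_sq]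

theorem hsNorm_opU₁_sub_opU₂ : hsNorm (opU₁ - opU₂) = 6 * √2 := by
  rw [opU₁_sub_opU₂_eq_supportingNormal, hsNorm_supportingNormal_three (one_pow 2)]

theorem isTangentWitness_rho {s α β : ℝ} (hs : |s| ≤ 1) (h : rho α β ∈ separableStates 3)
    (hαβ : (1 - α - β) / 9 + s * ((α - β / 2) / 3) = 0) :
    IsTangentWitness 2 (supportingNormal s) (rho α β) := by
  rw [rho_eq_invariantOp] at h ⊢
  have htangent := isTangentWitness_supportingNormal (by norm_num) hs h hαβ
  have hc : ((3 : ℕ) - 1 : ℝ) = 2 := by norm_num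
  rwa [hc] at htangent

theorem rho_facetI_sub_rho (α β : ℝ) :
    rho (1 / 4 + 1 / 8 * β) β - rho α β = ((α - 1 / 4 - 1 / 8 * β) / 9) • -opU := by
  rw [rho_eq_invariantOp, rho_eq_invariantOp, opU_eq_invariantOp]
  simp only [invariantOp]
  module

theorem rho_facetII_sub_rho (α β : ℝ) :
    rho (1 / 24 * (-2 + 20 * α + 5 * β)) (1 / 6 * (2 + 4 * α + β)) - rho α β =
      ((-4 * α - 2 + 5 * β) / 72) • (opU₁ - opU₂) := by
  rw [rho_eq_invariantOp, rho_eq_invariantOp, opU₁_eq_invariantOp, opU₂_eq_invariantOp]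
  simp only [invariantOp]
  module

theorem isTangentWitness_neg_opU {α β : ℝ} (h : RegionI α β) :
    IsTangentWitness 2 (-opU) (rho (1 / 4 + 1 / 8 * β) β) := by
  obtain ⟨hleft, htop, hI⟩ := h
  rw [neg_opU_eq_supportingNormal]
  refine isTangentWitness_rho (by norm_num) (rho_mem_separableStates (isDensity_rho_iff.2 ?_) ?_)
    (by ring)
  · refine ⟨?_, ?_, ?_⟩ <;> linarith
  · rw [abs_le]
    constructor <;> linarith

theorem isTangentWitness_opU₁_sub_opU₂ {α β : ℝ} (h : RegionII α β) :
    IsTangentWitness 2 (opU₁ - opU₂)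
      (rho (1 / 24 * (-2 + 20 * α + 5 * β)) (1 / 6 * (2 + 4 * α + β))) := by
  obtain ⟨hII, hbottom, htop⟩ := h
  rw [opU₁_sub_opU₂_eq_supportingNormal]
  refine isTangentWitness_rho (by norm_num) (rho_mem_separableStates (isDensity_rho_iff.2 ?_) ?_)
    (by ring)
  · refine ⟨?_, ?_, ?_⟩ <;> linarith
  · rw [abs_le]
    constructor <;> linarith

theorem hsMeasure_rho_of_regionI {α β : ℝ} (h : RegionI α β) :
    hsMeasure (rho α β) = 2 * √2 / 3 * (α - 1 / 4 - 1 / 8 * β) := by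
  rw [(isTangentWitness_neg_opU h).hsMeasure_eq (by linarith [h.2.2]) (rho_facetI_sub_rho α β),
    hsNorm_neg_opU]
  ring

theorem hsMeasure_rho_of_regionII {α β : ℝ} (h : RegionII α β) :
    hsMeasure (rho α β) = 1 / (6 * √2) * (-4 * α - 2 + 5 * β) := by
  rw [(isTangentWitness_opU₁_sub_opU₂ h).hsMeasure_eq (by linarith [h.1])
    (rho_facetII_sub_rho α β), hsNorm_opU₁_sub_opU₂]
  field_simp
  rw [Real.sq_sqrt zero_le_two]
  ring

end TwoQutrits

end TwoQudit

open TwoQudit in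
theorem mainTheorem3 :
    -- the Bloch form of the two-parameter operators, and which of them are entangled states
    (∀ α β : ℝ, rho α β = bloch (α - β / 2) (α + β)) ∧
    (∀ α β : ℝ, IsEntangled (rho α β) ↔ RegionI α β ∨ RegionII α β) ∧
    -- Region I
    (∀ α β : ℝ, RegionI α β →
      ∃ ρ₀ : Op 3,
        ρ₀ = rho (1 / 4 + 1 / 8 * β) β ∧
        ρ₀ = bloch (1 / 4 - 3 / 8 * β) (1 / 4 + 9 / 8 * β) ∧
        IsNearestSeparable (rho α β) ρ₀ ∧
        hsMeasure (rho α β) = hsNorm (ρ₀ - rho α β) ∧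
        hsMeasure (rho α β) = 2 * √2 / 3 * (α - 1 / 4 - 1 / 8 * β) ∧
        witnessOp ρ₀ (rho α β) = (1 / (6 * √2)) • ((2 : ℝ) • (1 : Op 3) - opU) ∧
        IsWitness (witnessOp ρ₀ (rho α β)) (rho α β) ∧
        hsInner (rho α β) (witnessOp ρ₀ (rho α β)) =
          ((-(2 * √2 / 3 * (α - 1 / 4 - 1 / 8 * β)) : ℝ) : ℂ)) ∧
    -- Region II
    (∀ α β : ℝ, RegionII α β →
      ∃ ρ₀ : Op 3,
        ρ₀ = rho (1 / 24 * (-2 + 20 * α + 5 * β)) (1 / 6 * (2 + 4 * α + β)) ∧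
        IsNearestSeparable (rho α β) ρ₀ ∧
        hsMeasure (rho α β) = hsNorm (ρ₀ - rho α β) ∧
        hsMeasure (rho α β) = 1 / (6 * √2) * (-4 * α - 2 + 5 * β) ∧
        witnessOp ρ₀ (rho α β) = (1 / (6 * √2)) • ((2 : ℝ) • (1 : Op 3) + opU₁ - opU₂) ∧
        IsWitness (witnessOp ρ₀ (rho α β)) (rho α β) ∧
        hsInner (rho α β) (witnessOp ρ₀ (rho α β)) =
          ((1 / (6 * √2) * (4 * α + 2 - 5 * β) : ℝ) : ℂ)) := by
  refine ⟨rho_eq_bloch, fun _ _ => isEntangled_rho_iff, fun α β h => ?_, fun α β h => ?_⟩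
  · have htangent := isTangentWitness_neg_opU h
    have hstep := rho_facetI_sub_rho α β
    have hpos : 0 < (α - 1 / 4 - 1 / 8 * β) / 9 := by linarith [h.2.2]
    have hnear := htangent.isNearestSeparable hpos hstep
    refine ⟨_, rfl, ?_, hnear, hnear.hsMeasure_eq, hsMeasure_rho_of_regionI h, ?_,
      htangent.isWitness hpos hstep, ?_⟩
    · rw [rho_eq_bloch]; congr 1 <;> ring
    · rw [htangent.witnessOp_eq hpos hstep, hsNorm_neg_opU, one_div, sub_eq_add_neg]
    · rw [htangent.hsInner_witnessOp hpos hstep, hsMeasure_rho_of_regionI h]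
  · have htangent := isTangentWitness_opU₁_sub_opU₂ h
    have hstep := rho_facetII_sub_rho α β
    have hpos : 0 < (-4 * α - 2 + 5 * β) / 72 := by linarith [h.1]
    have hnear := htangent.isNearestSeparable hpos hstep
    refine ⟨_, rfl, hnear, hnear.hsMeasure_eq, hsMeasure_rho_of_regionII h, ?_,
      htangent.isWitness hpos hstep, ?_⟩
    · rw [htangent.witnessOp_eq hpos hstep, hsNorm_opU₁_sub_opU₂, one_div, add_sub_assoc]
    · rw [htangent.hsInner_witnessOp hpos hstep, hsMeasure_rho_of_regionII h]; congr 1; ring
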